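/- Let $\kappa$ be a field and $G$ a group; algebras are associative and unital, and homomorphisms of algebras preserve the unit. A function $\sigma:G\times G\to\kappa$ is called a factor set if there are a $\kappa$-algebra $R$ and a map $\Gamma:G\to R$ with $\Gamma(1)=1_R$ such that for all $g,h\in G$: (i) if $\sigma(g,h)=0$ then $\Gamma(g^{-1})\Gamma(gh)=0$ and $\Gamma(gh)\Gamma(h^{-1})=0$; (ii) if $\Gamma(g)\Gamma(h)=0$ then $\sigma(g,h)=0$; (iii) $\Gamma(g^{-1})\Gamma(g)\Gamma(h)=\sigma(g,h)\Gamma(g^{-1})\Gamma(gh)$; (iv) $\Gamma(g)\Gamma(h)\Gamma(h^{-1})=\sigma(g,h)\Gamma(gh)\Gamma(h^{-1})$. For a function $\sigma:G\times G\to\kappa$, the twisted partial group algebra $\kappa_{par}^{\sigma}G$ is the universal unital $\kappa$-algebra generated by symbols $[g]^\sigma$ $(g\in G)$ subject to, for all $g,h\in G$: $[g^{-1}]^\sigma[gh]^\sigma=[gh]^\sigma[h^{-1}]^\sigma=0$ if $\sigma(g,h)=0$; $[g^{-1}]^\sigma[g]^\sigma[h]^\sigma=\sigma(g,h)[g^{-1}]^\sigma[gh]^\sigma$;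 $[g]^\sigma[h]^\sigma[h^{-1}]^\sigma=\sigma(g,h)[gh]^\sigma[h^{-1}]^\sigma$; and $[1]^\sigma=1$. For $\sigma\equiv 1$ write $\kappa_{par}G$ and $[g]$. Let $B$ be the (commutative) subalgebra of $\kappa_{par}G$ generated by the elements $e_g=[g][g^{-1}]$, $g\in G$. Let $\Omega=\{\xi\subseteq G: 1\in\xi\}$, and for $\xi\in\Omega$ let $f_\xi:B\to\kappa$ be the unique algebra homomorphism with $f_\xi(e_g)=1$ if $g\in\xi$ and $f_\xi(e_g)=0$ if $g\notin\xi$. For a function $\sigma:G\times G\to\kappa$ let $\mathcal I_\sigma$ be the ideal of $B$ generated by all $e_se_{sg}e_{sgh}$ with $\sigma(g,h)=0$ and all $e_se_{sg}e_{sgh}e_{sght}$ with $\sigma(g,h)\sigma(gh,t)\neq\sigma(g,ht)\sigma(h,t)$, and put $\Omega_\sigma=\{\xi\in\Omega:\mathcal I_\sigma\subseteq\ker f_\xi\}$. Equivalently, $\Omega_\sigma$ consists of the $\xi\in\Omega$ that contain no set $\{s,sg,sgh\}$ with $\sigma(g,h)=0$ and no set $\{s,sg,sgh,sght\}$ with $\sigma(g,h)\sigma(gh,t)\neq\sigma(g,ht)\sigma(h,t)$.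 Let $\chi(U)=1$ if $U\in\Omega_\sigma$ and $\chi(U)=0$ otherwise. Let $\sigma$ be a factor set. Let $\mathcal S^\sigma(G)$ be the set consisting of an element $0$ and the elements $k(U,g)$ with $k\in\kappa\setminus\{0\}$, $U\in\Omega_\sigma$ finite and $g\in U$, with the product $$k(U,g)\star r(V,h)=\sigma(g,h)\,\chi(U\cup gV)\,kr\,(U\cup gV,gh),$$ where an expression with coefficient zero means the element $0$, and $0$ is absorbing; it is a $\kappa$-cancellative monoid. Let $\mathcal A_\sigma$ be the $\kappa$-algebra with $\kappa$-basis the pairs $(U,g)$, $U\in\Omega_\sigma$ finite, $g\in U$, whose product is the bilinear extension of $\star$ (read in $\mathcal A_\sigma$). **Theorem.** For every field $\kappa$, every group $G$ and every factor set $\sigma$ of $G$ over $\kappa$ there is an isomorphism of unital $\kappa$-algebras $\phi:\kappa_{par}^{\sigma}G\to\mathcal A_\sigma$ such that $$\phi([g]^\sigma)=\chi(\{1,g\})\,(\{1,g\},g)\qquad\text{for all } g\in G,$$ where the right-hand side is $0$ if $\chi(\{1,g\})=0$. -/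

import Mathlib

open scoped Pointwise

universe u v w

noncomputable section

namespace TwistedPartial

section FactorSets

variable {κ : Type u} {G : Type v} [Field κ] [Group G]

/-- `Γ : G → R` is a partial projective `σ`-representation of `G` in the unital `κ`-algebra `R`. -/
structure IsPartialProjRep (σ : G → G → κ) {R : Type w} [Ring R] [Algebra κ R]
    (Γ : G → R) : Prop where
  left_zero : ∀ g h, σ g h = 0 → Γ g⁻¹ * Γ (g * h) = 0
  right_zero : ∀ g h, σ g h = 0 → Γ (g * h) * Γ h⁻¹ = 0
  zero_of_mul : ∀ g h, Γ g * Γ h = 0 → σ g h = 0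
  map_one : Γ 1 = 1
  left_mul : ∀ g h, Γ g⁻¹ * Γ g * Γ h = σ g h • (Γ g⁻¹ * Γ (g * h))
  right_mul : ∀ g h, Γ g * Γ h * Γ h⁻¹ = σ g h • (Γ (g * h) * Γ h⁻¹)

/-- `σ` is a factor set of `G` over `κ` (that is, `σ ∈ pm(G)`): it is the factor set of some partial
projective representation. Letting `R` range over one universe only is no restriction, see
`isFactorSet_of_rep` below. -/
class IsFactorSet (σ : G → G → κ) : Prop where
  exists_rep : ∃ (R : Type (max u v)) (_ : Ring R) (_ : Algebra κ R) (Γ : G → R),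
    IsPartialProjRep σ Γ

/-- The defining relations of the twisted partial group algebra, between elements of the free
unital `κ`-algebra on the symbols `[g]`. The relation `one` says that `[1]` is the unit, which for
an algebra generated by the symbols `[g]` is the relation `[g][1] = [1][g] = [g]`. -/
inductive ParRel (σ : G → G → κ) : FreeAlgebra κ G → FreeAlgebra κ G → Prop
  | left_zero (g h : G) (hσ : σ g h = 0) :
      ParRel σ (FreeAlgebra.ι κ g⁻¹ * FreeAlgebra.ι κ (g * h)) 0
  | right_zero (g h : G) (hσ : σ g h = 0) :
      ParRel σ (FreeAlgebra.ι κ (g * h) * FreeAlgebra.ι κ h⁻¹) 0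
  | left_mul (g h : G) :
      ParRel σ (FreeAlgebra.ι κ g⁻¹ * FreeAlgebra.ι κ g * FreeAlgebra.ι κ h)
        (σ g h • (FreeAlgebra.ι κ g⁻¹ * FreeAlgebra.ι κ (g * h)))
  | right_mul (g h : G) :
      ParRel σ (FreeAlgebra.ι κ g * FreeAlgebra.ι κ h * FreeAlgebra.ι κ h⁻¹)
        (σ g h • (FreeAlgebra.ι κ (g * h) * FreeAlgebra.ι κ h⁻¹))
  | one : ParRel σ (FreeAlgebra.ι κ 1) 1

/-- The twisted partial group algebra `κ_par^σ G`. -/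
def ParAlgebra (σ : G → G → κ) : Type (max u v) := RingQuot (ParRel σ)

instance (σ : G → G → κ) : Ring (ParAlgebra σ) := inferInstanceAs (Ring (RingQuot (ParRel σ)))

instance (σ : G → G → κ) : Algebra κ (ParAlgebra σ) :=
  inferInstanceAs (Algebra κ (RingQuot (ParRel σ)))

/-- The quotient map from the free algebra. -/
def ParAlgebra.mk (σ : G → G → κ) : FreeAlgebra κ G →ₐ[κ] ParAlgebra σ :=
  RingQuot.mkAlgHom κ (ParRel σ)

theorem ParAlgebra.mk_rel {σ : G → G → κ} {x y : FreeAlgebra κ G} (h : ParRel σ x y) :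
    ParAlgebra.mk σ x = ParAlgebra.mk σ y := RingQuot.mkAlgHom_rel κ h

/-- The generator `[g]^σ` of `κ_par^σ G`. -/
def bracket (σ : G → G → κ) (g : G) : ParAlgebra σ :=
  ParAlgebra.mk σ (FreeAlgebra.ι κ g)

theorem exists_lift (σ : G → G → κ) {R : Type w} [Ring R] [Algebra κ R] (Γ : G → R)
    (h1 : ∀ g h, σ g h = 0 → Γ g⁻¹ * Γ (g * h) = 0)
    (h2 : ∀ g h, σ g h = 0 → Γ (g * h) * Γ h⁻¹ = 0)
    (h3 : Γ 1 = 1)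
    (h4 : ∀ g h, Γ g⁻¹ * Γ g * Γ h = σ g h • (Γ g⁻¹ * Γ (g * h)))
    (h5 : ∀ g h, Γ g * Γ h * Γ h⁻¹ = σ g h • (Γ (g * h) * Γ h⁻¹)) :
    ∃ f : ParAlgebra σ →ₐ[κ] R, ∀ g, f (bracket σ g) = Γ g := by
  have hrel : ∀ ⦃x y⦄, ParRel σ x y → FreeAlgebra.lift κ Γ x = FreeAlgebra.lift κ Γ y := by
    intro x y h
    induction h <;> simp_all
  refine ⟨(RingQuot.liftAlgHom κ ⟨FreeAlgebra.lift κ Γ, hrel⟩ : RingQuot (ParRel σ) →ₐ[κ] R), ?_⟩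
  intro g
  exact (RingQuot.liftAlgHom_mkAlgHom_apply κ _ hrel _).trans (FreeAlgebra.lift_ι_apply Γ g)

/-- The universe of the representing algebra is irrelevant in `IsFactorSet`. -/
theorem isFactorSet_of_rep (σ : G → G → κ) {R : Type w} [Ring R] [Algebra κ R] (Γ : G → R)
    (hΓ : IsPartialProjRep σ Γ) : IsFactorSet σ := by
  refine ⟨ParAlgebra σ, inferInstance, inferInstance, bracket σ, ?_, ?_, ?_, ?_, ?_, ?_⟩
  · intro g h hσ
    simpa [bracket] using ParAlgebra.mk_rel (ParRel.left_zero (σ := σ) g h hσ)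
  · intro g h hσ
    simpa [bracket] using ParAlgebra.mk_rel (ParRel.right_zero (σ := σ) g h hσ)
  · intro g h h0
    obtain ⟨f, hf⟩ := exists_lift σ Γ hΓ.left_zero hΓ.right_zero hΓ.map_one hΓ.left_mul
      hΓ.right_mul
    apply hΓ.zero_of_mul
    rw [← hf, ← hf, ← map_mul, h0, map_zero]
  · simpa [bracket] using ParAlgebra.mk_rel (ParRel.one (σ := σ))
  · intro g h
    simpa [bracket] using ParAlgebra.mk_rel (ParRel.left_mul (σ := σ) g h)
  · intro g h
    simpa [bracket] using ParAlgebra.mk_rel (ParRel.right_mul (σ := σ) g h)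

theorem sigma_one_left {σ : G → G → κ} [hσ : IsFactorSet σ] {g : G} (h : σ 1 g ≠ 0) :
    σ 1 g = 1 := by
  obtain ⟨R, _, _, Γ, hΓ⟩ := hσ.exists_rep
  by_contra hne
  have h4 := hΓ.left_mul 1 g
  simp only [inv_one, one_mul, hΓ.map_one] at h4
  have h6 : (1 - σ 1 g) • Γ g = 0 := by rw [sub_smul, one_smul, ← h4, sub_self]
  have h7 : Γ g = 0 := (smul_eq_zero_iff_right (sub_ne_zero.mpr (Ne.symm hne))).mp h6
  exact h (hΓ.zero_of_mul 1 g (by rw [h7, mul_zero]))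

theorem sigma_one_right {σ : G → G → κ} [hσ : IsFactorSet σ] {g : G} (h : σ g 1 ≠ 0) :
    σ g 1 = 1 := by
  obtain ⟨R, _, _, Γ, hΓ⟩ := hσ.exists_rep
  by_contra hne
  have h4 := hΓ.right_mul g 1
  simp only [inv_one, mul_one, hΓ.map_one] at h4
  have h6 : (1 - σ g 1) • Γ g = 0 := by rw [sub_smul, one_smul, ← h4, sub_self]
  have h7 : Γ g = 0 := (smul_eq_zero_iff_right (sub_ne_zero.mpr (Ne.symm hne))).mp h6
  exact h (hΓ.zero_of_mul g 1 (by rw [h7, zero_mul]))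

end FactorSets

section Spectrum

variable (κ : Type u) (G : Type v) [Field κ] [Group G]

/-- The trivial factor set; `ParAlgebra (trivialFactor κ G)` is the partial group algebra
`κ_par G`. -/
def trivialFactor : G → G → κ := fun _ _ => 1

/-- The subalgebra `B` of `κ_par G` generated by the elements `e_g = [g][g⁻¹]`. -/
def subB : Subalgebra κ (ParAlgebra (trivialFactor κ G)) :=
  Algebra.adjoin κ
    (Set.range fun g : G => bracket (trivialFactor κ G) g * bracket (trivialFactor κ G) g⁻¹)

variable {G}

/-- The element `e_g = [g][g⁻¹]` of `B`. -/
def idemB (g : G) : subB κ G :=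
  ⟨bracket (trivialFactor κ G) g * bracket (trivialFactor κ G) g⁻¹,
    Algebra.subset_adjoin ⟨g, rfl⟩⟩

/-- Operators of a partial representation of `G` on the functions of subsets of `G`. It only
serves to prove that the characters of `B` exist. -/
def shiftOp (g : G) : Module.End κ (Set G → κ) := by
  classical
  exact
  { toFun := fun F η => if (1 ∈ η ↔ g ∈ η) then F (g⁻¹ • η) else 0
    map_add' := by intro F F'; funext η; by_cases h : (1 ∈ η ↔ g ∈ η) <;> simp [h]
    map_smul' := by intro c F; funext η; by_cases h : (1 ∈ η ↔ g ∈ η) <;> simp [h] }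

open Classical in
theorem shiftOp_apply (g : G) (F : Set G → κ) (η : Set G) :
    shiftOp κ g F η = if (1 ∈ η ↔ g ∈ η) then F (g⁻¹ • η) else 0 := rfl

open Classical in
theorem exists_unique_character (ξ : Set G) (hξ : 1 ∈ ξ) :
    ∃! f : subB κ G →ₐ[κ] κ, ∀ g, f (idemB κ g) = if g ∈ ξ then 1 else 0 := by
  obtain ⟨ψ, hψ⟩ := exists_lift (trivialFactor κ G) (shiftOp κ) (by simp [trivialFactor])
    (by simp [trivialFactor])
    (by ext F η; simp [shiftOp_apply])
    (by
      intro g h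
      apply LinearMap.ext; intro F; funext η
      simp only [trivialFactor, one_smul, Module.End.mul_apply, shiftOp_apply,
        Set.mem_smul_set_iff_inv_smul_mem, smul_eq_mul, inv_inv, mul_one, inv_mul_cancel,
        smul_smul, mul_inv_rev, inv_mul_cancel_left]
      by_cases h1 : (1 ∈ η) <;> by_cases h2 : (g⁻¹ ∈ η) <;> by_cases h3 : h ∈ η <;>
        simp [h1, h2, h3])
    (by
      intro g h
      apply LinearMap.ext; intro F; funext η
      simp only [trivialFactor, one_smul, Module.End.mul_apply, shiftOp_apply,
        Set.mem_smul_set_iff_inv_smul_mem, smul_eq_mul, inv_inv, mul_one,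
        smul_smul, mul_inv_rev, mul_inv_cancel_right, mul_inv_cancel_left]
      by_cases h1 : (1 ∈ η) <;> by_cases h2 : (g ∈ η) <;> by_cases h3 : g * h ∈ η <;>
        simp [h1, h2, h3])
  have he : ∀ g F η, ψ (idemB κ g : ParAlgebra (trivialFactor κ G)) F η =
      if (1 ∈ η ↔ g ∈ η) then F η else 0 := by
    intro g F η
    simp only [idemB, map_mul, hψ, Module.End.mul_apply, shiftOp_apply,
        Set.mem_smul_set_iff_inv_smul_mem, smul_eq_mul, inv_inv, mul_one,
        smul_smul, mul_inv_cancel, one_smul]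
    by_cases h1 : (1 ∈ η) <;> by_cases h2 : (g ∈ η) <;> simp [h1, h2]
  have hmul : ∀ b ∈ subB κ G, ∀ F, ψ b F = ψ b 1 * F := by
    intro b hb
    induction hb using Algebra.adjoin_induction with
    | mem x hx =>
      obtain ⟨g, rfl⟩ := hx
      intro F; funext η
      have h1 := he g F η
      have h2 := he g 1 η
      simp only [idemB] at h1 h2
      rw [Pi.mul_apply, h1, h2]
      split_ifs <;> simp
    | algebraMap r => intro F; simp [AlgHom.commutes]
    | add x y _ _ hx hy => intro F; simp only [map_add, LinearMap.add_apply, hx F, hy F, add_mul]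
    | mul x y _ _ hx hy =>
      intro F
      simp only [map_mul, Module.End.mul_apply]
      rw [hy F, hx (ψ y 1 * F), hx (ψ y 1), mul_assoc]
  let lin : subB κ G →ₗ[κ] κ :=
    { toFun := fun b => ψ (b : ParAlgebra (trivialFactor κ G)) 1 ξ
      map_add' := by intro x y; simp
      map_smul' := by intro c x; simp }
  refine ⟨AlgHom.ofLinearMap lin ?_ ?_, ?_, ?_⟩
  · simp [lin]
  · intro x y
    change ψ ((x * y : subB κ G) : ParAlgebra (trivialFactor κ G)) 1 ξ = ψ x.1 1 ξ * ψ y.1 1 ξ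
    rw [Subalgebra.coe_mul, map_mul, Module.End.mul_apply, hmul x.1 x.2]
    rfl
  · intro g
    change ψ (idemB κ g : ParAlgebra (trivialFactor κ G)) 1 ξ = _
    rw [he]
    simp [hξ]
  · intro f hf
    apply AlgHom.adjoin_ext
    rintro x ⟨g, rfl⟩
    refine (hf g).trans ?_
    change _ = ψ (idemB κ g : ParAlgebra (trivialFactor κ G)) 1 ξ
    rw [he]
    simp [hξ]

variable (G) in
/-- `Ω`, the set of all subsets of `G` containing `1`. -/
def Omega : Set (Set G) := {ξ | 1 ∈ ξ}

/-- For `ξ ∈ Ω`, the character `f_ξ : B → κ` with `f_ξ(e_g) = 1` if `g ∈ ξ` and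
`f_ξ(e_g) = 0` otherwise. -/
def character {ξ : Set G} (hξ : ξ ∈ Omega G) : subB κ G →ₐ[κ] κ :=
  (exists_unique_character κ ξ hξ).choose

open Classical in
theorem character_idemB {ξ : Set G} (hξ : ξ ∈ Omega G) (g : G) :
    character κ hξ (idemB κ g) = if g ∈ ξ then 1 else 0 :=
  (exists_unique_character κ ξ hξ).choose_spec.1 g

variable {κ}

/-- The ideal `I_σ` of the (commutative) algebra `B`. -/
def idealI (σ : G → G → κ) : TwoSidedIdeal (subB κ G) :=
  TwoSidedIdeal.span
    ({x | ∃ s g h, σ g h = 0 ∧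
        x = idemB κ s * idemB κ (s * g) * idemB κ (s * g * h)} ∪
     {x | ∃ s g h t, σ g h * σ (g * h) t ≠ σ g (h * t) * σ h t ∧
        x = idemB κ s * idemB κ (s * g) * idemB κ (s * g * h) * idemB κ (s * g * h * t)})

/-- `Ω_σ = {ξ ∈ Ω : I_σ ⊆ ker f_ξ}`. -/
def OmegaSigma (σ : G → G → κ) : Set (Set G) :=
  {ξ | ∃ hξ : ξ ∈ Omega G, idealI σ ≤ TwoSidedIdeal.ker (character κ hξ)}

/-- The `σ`-prohibitions of type I. -/
def prohibI (σ : G → G → κ) : Set (Set G) :=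
  {V | ∃ h g s, σ g s = 0 ∧ V = {h, h * g, h * g * s}}

/-- The `σ`-prohibitions of type II. -/
def prohibII (σ : G → G → κ) : Set (Set G) :=
  {V | ∃ h g s t, σ g (s * t) * σ s t ≠ σ g s * σ (g * s) t ∧
    V = {h, h * g, h * g * s, h * g * s * t}}

/-- `Ω_σ` consists of the sets containing `1` and containing no `σ`-prohibition. -/
theorem mem_OmegaSigma_iff (σ : G → G → κ) (ξ : Set G) :
    ξ ∈ OmegaSigma σ ↔ 1 ∈ ξ ∧ ∀ V ∈ prohibI σ ∪ prohibII σ, ¬ V ⊆ ξ := by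
  classical
  constructor
  · rintro ⟨hξ, hI⟩
    refine ⟨hξ, ?_⟩
    rintro V (⟨s, g, h, hσ, rfl⟩ | ⟨s, g, h, t, hσ, rfl⟩) hV
    · have h0 := (TwoSidedIdeal.mem_ker (character κ hξ)).mp
        (hI (TwoSidedIdeal.subset_span (Or.inl ⟨s, g, h, hσ, rfl⟩)))
      simp only [Set.insert_subset_iff, Set.singleton_subset_iff] at hV
      simp [character_idemB, hV] at h0
    · have h0 := (TwoSidedIdeal.mem_ker (character κ hξ)).mp
        (hI (TwoSidedIdeal.subset_span (Or.inr ⟨s, g, h, t, Ne.symm hσ, rfl⟩)))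
      simp only [Set.insert_subset_iff, Set.singleton_subset_iff] at hV
      simp [character_idemB, hV] at h0
  · rintro ⟨h1, hV⟩
    refine ⟨h1, ?_⟩
    rw [idealI, TwoSidedIdeal.span_le]
    rintro x (⟨s, g, h, hσ, rfl⟩ | ⟨s, g, h, t, hσ, rfl⟩)
    · have hn := hV _ (Or.inl ⟨s, g, h, hσ, rfl⟩)
      simp only [Set.insert_subset_iff, Set.singleton_subset_iff] at hn
      rw [SetLike.mem_coe, TwoSidedIdeal.mem_ker]
      simp only [map_mul, fun g => character_idemB κ (ξ := ξ) h1 g]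
      by_contra hc
      apply hn
      split_ifs at hc <;> simp_all
    · have hn := hV _ (Or.inr ⟨s, g, h, t, Ne.symm hσ, rfl⟩)
      simp only [Set.insert_subset_iff, Set.singleton_subset_iff] at hn
      rw [SetLike.mem_coe, TwoSidedIdeal.mem_ker]
      simp only [map_mul, fun g => character_idemB κ (ξ := ξ) h1 g]
      by_contra hc
      apply hn
      split_ifs at hc <;> simp_all

theorem OmegaSigma_subset {σ : G → G → κ} {U V : Set G} (hV : V ∈ OmegaSigma σ) (h1 : 1 ∈ U)
    (h : U ⊆ V) : U ∈ OmegaSigma σ := by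
  rw [mem_OmegaSigma_iff] at hV ⊢
  exact ⟨h1, fun W hW hWU => hV.2 W hW (hWU.trans h)⟩

theorem OmegaSigma_smul {σ : G → G → κ} {U : Set G} (hU : U ∈ OmegaSigma σ) {g : G} (hg : g ∈ U) :
    g⁻¹ • U ∈ OmegaSigma σ := by
  rw [mem_OmegaSigma_iff] at hU ⊢
  refine ⟨by simpa [Set.mem_smul_set_iff_inv_smul_mem] using hg, ?_⟩
  rintro V (⟨s, a, b, hσ, rfl⟩ | ⟨s, a, b, t, hσ, rfl⟩) hsub
  · refine hU.2 _ (Or.inl ⟨g * s, a, b, hσ, rfl⟩) ?_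
    simpa [Set.insert_subset_iff, Set.mem_smul_set_iff_inv_smul_mem, mul_assoc] using hsub
  · refine hU.2 _ (Or.inr ⟨g * s, a, b, t, hσ, rfl⟩) ?_
    simpa [Set.insert_subset_iff, Set.mem_smul_set_iff_inv_smul_mem, mul_assoc] using hsub

open Classical in
/-- The characteristic function `χ` of `Ω_σ`, with values in `κ`. -/
def chi (σ : G → G → κ) (U : Set G) : κ := if U ∈ OmegaSigma σ then 1 else 0

end Spectrum

section Monoid

variable {κ : Type u} {G : Type v} [Field κ] [Group G]

/-- The pairs `(U, g)` with `U` a finite element of `Ω_σ` and `g ∈ U`. -/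
@[ext]
structure Pairs (σ : G → G → κ) where
  set : Set G
  elt : G
  mem_Omega : set ∈ OmegaSigma σ
  finite : set.Finite
  elt_mem : elt ∈ set

/-- The set `S^σ(G)`: the triples `(k, U, g)` with `k ≠ 0`, `U` a finite element of `Ω_σ` and
`g ∈ U`, and an additional element `0`. -/
inductive CancMonoid (σ : G → G → κ)
  | zero : CancMonoid σ
  | mk (k : κ) (hk : k ≠ 0) (p : Pairs σ) : CancMonoid σ

namespace CancMonoid

variable {σ : G → G → κ}

open Classical in
/-- The element `k(U, g)` of `S^σ(G)`, which is `0` when `k = 0` (by convention also when `(U, g)`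
is not a pair as required). -/
def of (σ : G → G → κ) (k : κ) (U : Set G) (g : G) : CancMonoid σ :=
  if h : k ≠ 0 ∧ U ∈ OmegaSigma σ ∧ U.Finite ∧ g ∈ U then
    mk k h.1 ⟨U, g, h.2.1, h.2.2.1, h.2.2.2⟩ else zero

instance : Zero (CancMonoid σ) := ⟨zero⟩

instance : One (CancMonoid σ) := ⟨of σ 1 {1} 1⟩

/-- The product `k(U,g) ⋆ r(V,h) = σ(g,h) χ(U ∪ gV) k r (U ∪ gV, gh)`. -/
instance : Mul (CancMonoid σ) where
  mul
    | mk k _ p, mk r _ q =>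
      of σ (σ p.elt q.elt * chi σ (p.set ∪ p.elt • q.set) * k * r)
        (p.set ∪ p.elt • q.set) (p.elt * q.elt)
    | _, _ => zero

/-- The action of `κ` on `S^σ(G)`. -/
instance : SMul κ (CancMonoid σ) where
  smul r
    | mk k _ p => of σ (r * k) p.set p.elt
    | zero => zero

theorem mk_mul_mk (k r : κ) (hk : k ≠ 0) (hr : r ≠ 0) (p q : Pairs σ) :
    mk k hk p * mk r hr q =
      of σ (σ p.elt q.elt * chi σ (p.set ∪ p.elt • q.set) * k * r)
        (p.set ∪ p.elt • q.set) (p.elt * q.elt) := rfl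

end CancMonoid

/-- The `κ`-vector space `A_σ` with basis the pairs `(U, g)`. -/
def AlgA (σ : G → G → κ) : Type (max u v) := Pairs σ →₀ κ

namespace AlgA

variable {σ : G → G → κ}

instance : AddCommGroup (AlgA σ) := inferInstanceAs (AddCommGroup (Pairs σ →₀ κ))

instance : Module κ (AlgA σ) := inferInstanceAs (Module κ (Pairs σ →₀ κ))

/-- The embedding `k(U,g) ↦ k(U,g)` of `S^σ(G)` into `A_σ`. -/
def emb : CancMonoid σ → AlgA σ
  | .zero => 0
  | .mk k _ p => (Finsupp.single p k : Pairs σ →₀ κ)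

/-- The bilinear product of `A_σ` which on basis elements is the product of `S^σ(G)`. -/
def mulMap (σ : G → G → κ) : AlgA σ →ₗ[κ] AlgA σ →ₗ[κ] AlgA σ :=
  Finsupp.linearCombination κ fun p : Pairs σ =>
    (Finsupp.linearCombination κ fun q : Pairs σ =>
      emb (CancMonoid.mk 1 one_ne_zero p * CancMonoid.mk 1 one_ne_zero q) : AlgA σ →ₗ[κ] AlgA σ)

instance : Mul (AlgA σ) := ⟨fun x y => mulMap σ x y⟩

/-- The basis element `(U, g)` of `A_σ` (by convention `0` when `(U, g)` is not a pair as
required). -/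
def pair (σ : G → G → κ) (U : Set G) (g : G) : AlgA σ := emb (CancMonoid.of σ 1 U g)

/-- The unit `({1}, 1)`. -/
instance : One (AlgA σ) := ⟨pair σ {1} 1⟩

theorem pair_of_mem (p : Pairs σ) : pair σ p.set p.elt = (Finsupp.single p 1 : Pairs σ →₀ κ) := by
  rw [pair, CancMonoid.of, dif_pos ⟨one_ne_zero, p.mem_Omega, p.finite, p.elt_mem⟩]
  rfl

theorem pair_eq_zero {U : Set G} {g : G} (h : ¬ (U ∈ OmegaSigma σ ∧ U.Finite ∧ g ∈ U)) :
    pair σ U g = 0 := by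
  rw [pair, CancMonoid.of, dif_neg (fun h' => h h'.2)]
  rfl

theorem emb_of (k : κ) (U : Set G) (g : G) : emb (CancMonoid.of σ k U g) = k • pair σ U g := by
  by_cases h : U ∈ OmegaSigma σ ∧ U.Finite ∧ g ∈ U
  · by_cases hk : k = 0
    · rw [CancMonoid.of, dif_neg (by simp [hk]), hk, zero_smul]
      rfl
    · rw [CancMonoid.of, dif_pos ⟨hk, h⟩, pair_of_mem ⟨U, g, h.1, h.2.1, h.2.2⟩]
      exact (Finsupp.smul_single_one _ _).symm
  · rw [pair_eq_zero h, smul_zero, CancMonoid.of, dif_neg (fun h' => h h'.2)]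
    rfl

theorem chi_smul_pair (U : Set G) (g : G) : chi σ U • pair σ U g = pair σ U g := by
  by_cases h : U ∈ OmegaSigma σ
  · simp [chi, h]
  · rw [pair_eq_zero (fun h' => h h'.1), smul_zero]

theorem mul_def' (x y : AlgA σ) : x * y = mulMap σ x y := rfl

theorem mulMap_single (p q : Pairs σ) (x y : AlgA σ)
    (hx : x = (Finsupp.single p 1 : Pairs σ →₀ κ)) (hy : y = (Finsupp.single q 1 : Pairs σ →₀ κ)) :
    x * y = emb (CancMonoid.mk 1 one_ne_zero p * CancMonoid.mk 1 one_ne_zero q) := by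
  subst hx hy
  change (Finsupp.linearCombination κ fun p : Pairs σ =>
    (Finsupp.linearCombination κ fun q : Pairs σ =>
      emb (CancMonoid.mk 1 one_ne_zero p * CancMonoid.mk 1 one_ne_zero q) :
      (Pairs σ →₀ κ) →ₗ[κ] AlgA σ)) (Finsupp.single p 1) (Finsupp.single q 1) = _
  rw [Finsupp.linearCombination_single, one_smul, Finsupp.linearCombination_single, one_smul]

/-- Multiplication of basis elements. -/
theorem pair_mul_pair {U V : Set G} {g h : G} (hU : 1 ∈ U) (hV : 1 ∈ V) (hg : g ∈ U) (hh : h ∈ V) :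
    pair σ U g * pair σ V h = σ g h • pair σ (U ∪ g • V) (g * h) := by
  by_cases hp : (U ∈ OmegaSigma σ ∧ U.Finite ∧ g ∈ U) ∧ (V ∈ OmegaSigma σ ∧ V.Finite ∧ h ∈ V)
  · let p : Pairs σ := ⟨U, g, hp.1.1, hp.1.2.1, hp.1.2.2⟩
    let q : Pairs σ := ⟨V, h, hp.2.1, hp.2.2.1, hp.2.2.2⟩
    have e1 : pair σ U g = (Finsupp.single p 1 : Pairs σ →₀ κ) := pair_of_mem p
    have e2 : pair σ V h = (Finsupp.single q 1 : Pairs σ →₀ κ) := pair_of_mem q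
    rw [mulMap_single p q _ _ e1 e2, CancMonoid.mk_mul_mk, emb_of, mul_one, mul_one, mul_smul, chi_smul_pair]
  · have hz : pair σ (U ∪ g • V) (g * h) = 0 := by
      apply pair_eq_zero
      rintro ⟨hO, hf, -⟩
      apply hp
      rw [Set.finite_union] at hf
      refine ⟨⟨OmegaSigma_subset hO hU Set.subset_union_left, hf.1, hg⟩,
        OmegaSigma_subset (OmegaSigma_smul hO (Or.inl hg)) hV ?_,
        Set.Finite.of_smul_set hf.2, hh⟩
      intro x hx
      rw [Set.mem_smul_set_iff_inv_smul_mem, inv_inv]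
      exact Or.inr (Set.smul_mem_smul_set hx)
    rw [hz, smul_zero]
    rw [not_and_or] at hp
    rcases hp with hp | hp
    · rw [pair_eq_zero hp, mul_def', map_zero, LinearMap.zero_apply]
    · rw [pair_eq_zero hp, mul_def', map_zero]

theorem one_mem (p : Pairs σ) : 1 ∈ p.set := ((mem_OmegaSigma_iff σ _).mp p.mem_Omega).1

theorem induction_pair {P : AlgA σ → Prop} (x : AlgA σ) (h0 : P 0)
    (hadd : ∀ x y, P x → P y → P (x + y)) (hs : ∀ (k : κ) (p : Pairs σ),
      P (k • pair σ p.set p.elt)) : P x := by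
  refine Finsupp.induction_linear (motive := fun y : Pairs σ →₀ κ => P y) x h0 hadd ?_
  intro p k
  have h := hs k p
  rw [pair_of_mem] at h
  exact (congrArg P (Finsupp.smul_single_one p k)).mp h

theorem smul_mul' (k : κ) (x y : AlgA σ) : k • x * y = k • (x * y) := by
  simp [mul_def']

theorem mul_smul' (k : κ) (x y : AlgA σ) : x * k • y = k • (x * y) := by
  simp [mul_def']

theorem add_mul' (x y z : AlgA σ) : (x + y) * z = x * z + y * z := by
  simp [mul_def']

theorem mul_add' (x y z : AlgA σ) : x * (y + z) = x * y + x * z := by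
  simp [mul_def']

theorem zero_mul' (x : AlgA σ) : 0 * x = 0 := by simp [mul_def']

theorem mul_zero' (x : AlgA σ) : x * 0 = 0 := by simp [mul_def']

theorem mul_assoc' (x y z : AlgA σ) : x * y * z = x * (y * z) := by
  induction x using induction_pair with
  | h0 => simp only [zero_mul']
  | hadd x x' hx hx' => simp only [add_mul', hx, hx']
  | hs k p =>
  induction y using induction_pair with
  | h0 => simp only [zero_mul', mul_zero']
  | hadd x x' hx hx' => simp only [add_mul', mul_add', hx, hx']
  | hs l q =>
  induction z using induction_pair with
  | h0 => simp only [mul_zero']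
  | hadd x x' hx hx' => simp only [mul_add', hx, hx']
  | hs m r =>
  simp only [smul_mul', mul_smul']
  congr 3
  rw [pair_mul_pair (one_mem p) (one_mem q) p.elt_mem q.elt_mem,
    pair_mul_pair (one_mem q) (one_mem r) q.elt_mem r.elt_mem, smul_mul', mul_smul',
    pair_mul_pair (g := p.elt * q.elt) (Set.mem_union_left _ (one_mem p)) (one_mem r)
      (Set.mem_union_right _ (Set.smul_mem_smul_set q.elt_mem)) r.elt_mem,
    pair_mul_pair (h := q.elt * r.elt) (one_mem p) (Set.mem_union_left _ (one_mem q)) p.elt_mem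
      (Set.mem_union_right _ (Set.smul_mem_smul_set r.elt_mem)),
    Set.smul_set_union, smul_smul, ← Set.union_assoc, mul_assoc, smul_smul, smul_smul]
  by_cases hO : p.set ∪ p.elt • q.set ∪ (p.elt * q.elt) • r.set ∈ OmegaSigma σ
  · congr 1
    by_contra hne
    refine ((mem_OmegaSigma_iff σ _).mp hO).2 _
      (Or.inr ⟨1, p.elt, q.elt, r.elt, fun h => hne (by rw [← h, mul_comm]), rfl⟩) ?_
    simp only [Set.insert_subset_iff, Set.singleton_subset_iff, one_mul]
    exact ⟨Or.inl (Or.inl (one_mem p)), Or.inl (Or.inl p.elt_mem),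
      Or.inl (Or.inr (Set.smul_mem_smul_set q.elt_mem)),
      Or.inr (Set.smul_mem_smul_set r.elt_mem)⟩
  · rw [pair_eq_zero (fun h => hO h.1), smul_zero, smul_zero]

theorem one_mul' [IsFactorSet σ] (x : AlgA σ) : 1 * x = x := by
  induction x using induction_pair with
  | h0 => simp only [mul_zero']
  | hadd x x' hx hx' => simp only [mul_add', hx, hx']
  | hs k p =>
  rw [mul_smul']
  congr 1
  change pair σ {1} 1 * _ = _
  rw [pair_mul_pair (Set.mem_singleton 1) (one_mem p) (Set.mem_singleton 1) p.elt_mem, one_smul, one_mul, Set.union_eq_self_of_subset_left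
    (Set.singleton_subset_iff.mpr (one_mem p)), sigma_one_left (σ := σ), one_smul]
  intro h
  refine ((mem_OmegaSigma_iff σ _).mp p.mem_Omega).2 _ (Or.inl ⟨1, 1, p.elt, h, rfl⟩) ?_
  simp [Set.insert_subset_iff, one_mem p, p.elt_mem]

theorem mul_one' [IsFactorSet σ] (x : AlgA σ) : x * 1 = x := by
  induction x using induction_pair with
  | h0 => simp only [zero_mul']
  | hadd x x' hx hx' => simp only [add_mul', hx, hx']
  | hs k p =>
  rw [smul_mul']
  congr 1
  change _ * pair σ {1} 1 = _
  rw [pair_mul_pair (one_mem p) (Set.mem_singleton 1) p.elt_mem (Set.mem_singleton 1), mul_one, Set.smul_set_singleton, smul_eq_mul,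
    mul_one, Set.union_eq_self_of_subset_right (Set.singleton_subset_iff.mpr p.elt_mem),
    sigma_one_right (σ := σ), one_smul]
  intro h
  refine ((mem_OmegaSigma_iff σ _).mp p.mem_Omega).2 _ (Or.inl ⟨1, p.elt, 1, h, rfl⟩) ?_
  simp [Set.insert_subset_iff, one_mem p, p.elt_mem]

instance [IsFactorSet σ] : Ring (AlgA σ) :=
  { (inferInstance : AddCommGroup (AlgA σ)), (inferInstance : Mul (AlgA σ)),
    (inferInstance : One (AlgA σ)) with
    left_distrib := mul_add'
    right_distrib := add_mul'
    zero_mul := zero_mul'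
    mul_zero := mul_zero'
    mul_assoc := mul_assoc'
    one_mul := one_mul'
    mul_one := mul_one' }

instance [IsFactorSet σ] : Algebra κ (AlgA σ) := Algebra.ofModule smul_mul' mul_smul'

theorem emb_mk (k : κ) (hk : k ≠ 0) (p : Pairs σ) :
    emb (CancMonoid.mk k hk p) = k • pair σ p.set p.elt := by
  rw [pair_of_mem]
  exact (Finsupp.smul_single_one _ _).symm

/-- The embedding of `S^σ(G)` into `A_σ` is multiplicative. -/
theorem emb_mul (x y : CancMonoid σ) : emb (x * y) = emb x * emb y := by
  cases x with
  | zero => exact (zero_mul' _).symm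
  | mk k hk p =>
  cases y with
  | zero => exact (mul_zero' _).symm
  | mk r hr q =>
  rw [CancMonoid.mk_mul_mk, emb_of, emb_mk, emb_mk, smul_mul', mul_smul',
    pair_mul_pair (one_mem p) (one_mem q) p.elt_mem q.elt_mem, smul_smul, smul_smul]
  rw [show σ p.elt q.elt * chi σ (p.set ∪ p.elt • q.set) * k * r =
    (k * r * σ p.elt q.elt) * chi σ (p.set ∪ p.elt • q.set) by ring, mul_smul, chi_smul_pair]

theorem emb_injective : Function.Injective (emb : CancMonoid σ → AlgA σ) := by
  intro x y h
  cases x with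
  | zero =>
    cases y with
    | zero => rfl
    | mk r hr q => exact absurd (Finsupp.single_eq_zero.mp h.symm) hr
  | mk k hk p =>
    cases y with
    | zero => exact absurd (Finsupp.single_eq_zero.mp h) hk
    | mk r hr q =>
      rcases (Finsupp.single_eq_single_iff _ _ _ _).mp h with ⟨rfl, rfl⟩ | ⟨h1, _⟩
      · rfl
      · exact absurd h1 hk

end AlgA

/-- For a factor set `σ`, `S^σ(G)` is a monoid with zero. -/
instance (σ : G → G → κ) [IsFactorSet σ] : MonoidWithZero (CancMonoid σ) where
  mul_assoc x y z := AlgA.emb_injective (by simp only [AlgA.emb_mul, mul_assoc])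
  one_mul x := AlgA.emb_injective (by rw [AlgA.emb_mul]; exact AlgA.one_mul' _)
  mul_one x := AlgA.emb_injective (by rw [AlgA.emb_mul]; exact AlgA.mul_one' _)
  zero_mul x := rfl
  mul_zero x := by cases x <;> rfl

/-- `S^σ(G)` is `κ`-cancellative. -/
theorem CancMonoid.cancellative (σ : G → G → κ) (x : CancMonoid σ) (hx : x ≠ 0) (r t : κ)
    (h : r • x = t • x) : r = t := by
  cases x with
  | zero => exact absurd rfl hx
  | mk k hk p =>
    have h' : of σ (r * k) p.set p.elt = of σ (t * k) p.set p.elt := h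
    have h2 := congrArg AlgA.emb h'
    rw [AlgA.emb_of, AlgA.emb_of, AlgA.pair_of_mem] at h2
    have h3 := DFunLike.congr_fun (F := Pairs σ →₀ κ) h2 p
    erw [Finsupp.smul_apply, Finsupp.smul_apply] at h3
    simpa [hk] using h3

end Monoid

end TwistedPartial

end

/-! For a partial projective representation `Γ`, put `e_g = σ(g, g⁻¹)⁻¹ Γ(g) Γ(g⁻¹)`. These are
commuting idempotents with `Γ(g) e_h = e_{gh} Γ(g)` (`apply_mul_idem`) and `Γ(g) Γ(h) = σ(g, h) e_g
Γ(gh)` (`apply_mul_apply`). Writing `e_U` for the product of the `e_u` with `u ∈ U`, the elements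
`e_U Γ(g)` therefore multiply like the pairs `(U, g)`. Moreover `e_U = 0` when `1 ∈ U` and `U ∉ Ω_σ`
(`idemProd_eq_zero`): a zero of `σ` or a failure of the cocycle identity along `U` forces the
product to vanish.

The map `κ_par^σ G → A_σ` comes from the universal property (`exists_toAlgA`). With `Γ` the
universal representation `g ↦ [g]^σ`, the linear map `(U, g) ↦ e_U [g]^σ` is a left inverse of it,
because it intertwines left multiplication by the generators (`ofAlgA_pair_mul`). Surjectivity holds
because `[u]^σ [u⁻¹]^σ` acts on pairs by adjoining `u` to the set, up to a nonzero scalar whenever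
the enlarged set lies in `Ω_σ`. -/

namespace TwistedPartial

/-! ### Idempotents attached to a partial projective representation. -/

namespace IsPartialProjRep

variable {κ : Type u} {G : Type v} [Field κ] [Group G] {σ : G → G → κ} {R : Type w} [Ring R]
  [Algebra κ R] {Γ : G → R}

theorem apply_eq_zero_of_sigma_inv (hΓ : IsPartialProjRep σ Γ) {g : G} (h : σ g g⁻¹ = 0) :
    Γ g = 0 := by
  simpa [hΓ.map_one] using hΓ.right_zero g g⁻¹ h

theorem mul_inv_mul (hΓ : IsPartialProjRep σ Γ) (g : G) :
    Γ g * Γ g⁻¹ * Γ g = σ g g⁻¹ • Γ g := by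
  simpa [hΓ.map_one] using hΓ.right_mul g g⁻¹

/-- `left_mul` and `right_mul` evaluate the same product `Γ(g) Γ(g⁻¹) Γ(g)` as two multiples of
`Γ(g)`. -/
theorem sigma_inv_comm (hΓ : IsPartialProjRep σ Γ) {g : G} (h : Γ g ≠ 0) :
    σ g⁻¹ g = σ g g⁻¹ := by
  have h1 : Γ g * Γ g⁻¹ * Γ g = σ g⁻¹ g • Γ g := by
    simpa [hΓ.map_one] using hΓ.left_mul g⁻¹ g
  rw [hΓ.mul_inv_mul] at h1
  exact (smul_left_injective κ h h1).symm

/-- The idempotent `σ(g, g⁻¹)⁻¹ Γ(g) Γ(g⁻¹)`, which is `0` when `Γ(g) = 0`. -/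
def idem (_ : IsPartialProjRep σ Γ) (g : G) : R := (σ g g⁻¹)⁻¹ • (Γ g * Γ g⁻¹)

theorem idem_of_eq_zero (hΓ : IsPartialProjRep σ Γ) {g : G} (h : Γ g = 0) : hΓ.idem g = 0 := by
  rw [idem, h, zero_mul, smul_zero]

theorem idem_one (hΓ : IsPartialProjRep σ Γ) : hΓ.idem 1 = 1 := by
  have h := hΓ.mul_inv_mul 1
  simp only [inv_one, hΓ.map_one, mul_one] at h
  rw [idem, inv_one, hΓ.map_one, mul_one]
  by_cases h0 : σ 1 1 = 0
  -- Degenerate case: here `1 = σ(1, 1) • 1 = 0`, so `R` is the zero ring.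
  · rw [h0, zero_smul] at h
    rw [h, smul_zero]
  · exact (inv_smul_eq_iff₀ h0).mpr h

theorem idem_mul_self_apply (hΓ : IsPartialProjRep σ Γ) (g : G) : hΓ.idem g * Γ g = Γ g := by
  by_cases h0 : σ g g⁻¹ = 0
  · rw [hΓ.apply_eq_zero_of_sigma_inv h0, mul_zero]
  · rw [idem, smul_mul_assoc, hΓ.mul_inv_mul, inv_smul_smul₀ h0]

theorem idem_mul_idem (hΓ : IsPartialProjRep σ Γ) (g : G) :
    hΓ.idem g * hΓ.idem g = hΓ.idem g := by
  conv_lhs => rhs; rw [idem]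
  rw [mul_smul_comm, ← mul_assoc, idem_mul_self_apply, idem]

theorem apply_mul_idem_inv (hΓ : IsPartialProjRep σ Γ) (g : G) : Γ g * hΓ.idem g⁻¹ = Γ g := by
  by_cases h : Γ g = 0
  · rw [h, zero_mul]
  · have h0 : σ g g⁻¹ ≠ 0 := fun h' => h (hΓ.apply_eq_zero_of_sigma_inv h')
    rw [idem, inv_inv, mul_smul_comm, ← mul_assoc, hΓ.mul_inv_mul, hΓ.sigma_inv_comm h,
      inv_smul_smul₀ h0]

/-- `left_mul` only applies behind a factor `Γ(g⁻¹)`; inserting `e_g` in front of `Γ(g)` supplies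
one at no cost. -/
theorem apply_mul_apply (hΓ : IsPartialProjRep σ Γ) (g h : G) :
    Γ g * Γ h = σ g h • (hΓ.idem g * Γ (g * h)) := by
  conv_lhs => rw [← hΓ.idem_mul_self_apply g]
  by_cases hg : Γ g = 0
  · rw [hg, hΓ.idem_of_eq_zero hg]; simp
  · have h0 : σ g g⁻¹ ≠ 0 := fun h' => hg (hΓ.apply_eq_zero_of_sigma_inv h')
    simp only [idem, smul_mul_assoc]
    rw [mul_assoc, mul_assoc, ← mul_assoc (Γ g⁻¹), hΓ.left_mul, mul_smul_comm, smul_comm, mul_assoc]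

theorem apply_mul_apply' (hΓ : IsPartialProjRep σ Γ) (g h : G) :
    Γ g * Γ h = σ g h • (Γ (g * h) * hΓ.idem h⁻¹) := by
  conv_lhs => rw [← hΓ.apply_mul_idem_inv h]
  rw [idem, inv_inv, mul_smul_comm, mul_smul_comm, ← mul_assoc, ← mul_assoc, hΓ.right_mul,
    smul_mul_assoc, mul_smul_comm, smul_comm, mul_assoc]

/-- Both sides, multiplied by `σ(gh, h⁻¹)`, equal `Γ(gh) Γ(h⁻¹)`. If this scalar vanishes, so does
that product, and each side is a multiple of it or of a product containing it. -/
theorem apply_mul_idem (hΓ : IsPartialProjRep σ Γ) (g h : G) :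
    Γ g * hΓ.idem h = hΓ.idem (g * h) * Γ g := by
  have h1 := hΓ.apply_mul_apply (g * h) h⁻¹
  have h2 := hΓ.apply_mul_apply' (g * h) h⁻¹
  rw [mul_inv_cancel_right] at h1 h2
  rw [inv_inv] at h2
  by_cases h0 : σ (g * h) h⁻¹ = 0
  · have h3 : Γ (g * h) * Γ h⁻¹ = 0 := by rw [h1, h0, zero_smul]
    have h4 := hΓ.left_mul (g * h)⁻¹ g
    rw [inv_inv, mul_inv_rev, inv_mul_cancel_right, h3, smul_zero] at h4
    rw [idem, idem, mul_smul_comm, ← mul_assoc, hΓ.right_mul, h3, smul_mul_assoc, mul_inv_rev, h4]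
    simp
  · rw [h1] at h2
    exact (smul_right_injective R h0 h2).symm

/-- Pushing `e_h` leftwards through `Γ(g) Γ(g⁻¹)` translates its index by `g⁻¹` and then by `g`,
hence leaves it unchanged. -/
theorem idem_commute (hΓ : IsPartialProjRep σ Γ) (g h : G) :
    Commute (hΓ.idem g) (hΓ.idem h) := by
  change hΓ.idem g * hΓ.idem h = hΓ.idem h * hΓ.idem g
  rw [idem.eq_def hΓ g, smul_mul_assoc, mul_assoc, hΓ.apply_mul_idem, ← mul_assoc,
    hΓ.apply_mul_idem, mul_inv_cancel_left, mul_smul_comm, mul_assoc]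

theorem idem_mul_idem_eq_zero (hΓ : IsPartialProjRep σ Γ) {g h : G} (hσ : σ g h = 0) :
    hΓ.idem g * hΓ.idem (g * h) = 0 := by
  simp only [idem, smul_mul_assoc, mul_smul_comm]
  rw [mul_assoc, ← mul_assoc (Γ g⁻¹), hΓ.left_zero g h hσ]
  simp

/-- The two bracketings of `Γ(g) Γ(h) Γ(t)` give different multiples of `e_g e_{gh} Γ(ght)`, which
must therefore be zero. -/
theorem idem_mul_idem_mul_idem_eq_zero (hΓ : IsPartialProjRep σ Γ) {g h t : G}
    (hσ : σ g (h * t) * σ h t ≠ σ g h * σ (g * h) t) :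
    hΓ.idem g * hΓ.idem (g * h) * hΓ.idem (g * h * t) = 0 := by
  have h1 : Γ g * Γ h * Γ t =
      (σ g h * σ (g * h) t) • (hΓ.idem g * hΓ.idem (g * h) * Γ (g * h * t)) := by
    rw [hΓ.apply_mul_apply, smul_mul_assoc, mul_assoc, hΓ.apply_mul_apply, mul_smul_comm,
      smul_smul, ← mul_assoc]
  have h2 : Γ g * (Γ h * Γ t) =
      (σ g (h * t) * σ h t) • (hΓ.idem g * hΓ.idem (g * h) * Γ (g * h * t)) := by
    rw [hΓ.apply_mul_apply h t, mul_smul_comm, ← mul_assoc, hΓ.apply_mul_idem, mul_assoc,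
      hΓ.apply_mul_apply, mul_smul_comm, smul_smul, mul_comm (σ h t), ← mul_assoc,
      (hΓ.idem_commute (g * h) g).eq, mul_assoc g]
  have h3 : hΓ.idem g * hΓ.idem (g * h) * Γ (g * h * t) = 0 := by
    by_contra h0
    rw [← mul_assoc, h1] at h2
    exact hσ (smul_left_injective κ h0 h2).symm
  rw [idem.eq_def hΓ (g * h * t), mul_smul_comm, ← mul_assoc, h3, zero_mul, smul_zero]

/-! ### Products of idempotents over finite sets, and their vanishing outside `Ω_σ`. -/

/-- The product of the idempotents attached to the elements of a finite set. -/
def idemProd (hΓ : IsPartialProjRep σ Γ) (U : Finset G) : R :=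
  U.noncommProd hΓ.idem fun _ _ _ _ _ => hΓ.idem_commute _ _

theorem idem_commute_idemProd (hΓ : IsPartialProjRep σ Γ) (g : G) (U : Finset G) :
    Commute (hΓ.idem g) (hΓ.idemProd U) :=
  Finset.noncommProd_commute _ _ _ _ fun x _ => hΓ.idem_commute g x

theorem idemProd_empty (hΓ : IsPartialProjRep σ Γ) : hΓ.idemProd ∅ = 1 :=
  Finset.noncommProd_empty _ _

open Classical in
theorem idemProd_insert (hΓ : IsPartialProjRep σ Γ) (g : G) (U : Finset G) :
    hΓ.idemProd (insert g U) = hΓ.idem g * hΓ.idemProd U := by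
  have key : ∀ V : Finset G, g ∉ V → hΓ.idemProd (insert g V) = hΓ.idem g * hΓ.idemProd V :=
    fun V hV => Finset.noncommProd_insert_of_notMem _ _ _ _ hV
  by_cases hg : g ∈ U
  · rw [Finset.insert_eq_of_mem hg, ← Finset.insert_erase hg, key _ (Finset.notMem_erase g U),
      ← mul_assoc, idem_mul_idem]
  · exact key U hg

open Classical in
theorem idemProd_union (hΓ : IsPartialProjRep σ Γ) (U V : Finset G) :
    hΓ.idemProd (U ∪ V) = hΓ.idemProd U * hΓ.idemProd V := by
  induction U using Finset.induction_on with
  | empty => rw [Finset.empty_union, idemProd_empty, one_mul]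
  | insert g U _ ih => rw [Finset.insert_union, idemProd_insert, ih, idemProd_insert, mul_assoc]

open Classical in
theorem apply_mul_idemProd (hΓ : IsPartialProjRep σ Γ) (g : G) (U : Finset G) :
    Γ g * hΓ.idemProd U = hΓ.idemProd (U.image (g * ·)) * Γ g := by
  induction U using Finset.induction_on with
  | empty => simp [idemProd_empty]
  | insert h U _ ih =>
    rw [Finset.image_insert, idemProd_insert, idemProd_insert, ← mul_assoc, apply_mul_idem,
      mul_assoc, ih, mul_assoc]

theorem idemProd_eq_zero_of_subset (hΓ : IsPartialProjRep σ Γ) {U V : Finset G} (h : V ⊆ U)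
    (hV : hΓ.idemProd V = 0) : hΓ.idemProd U = 0 := by
  classical
  rw [← Finset.union_eq_right.mpr h, idemProd_union, hV, zero_mul]

-- Moving the factor `Γ(s)` of `e_s` leftwards through the product over `sU` turns that product into
-- the one over `U`. The extra factor `e_s` is what provides `Γ(s)`.
open Classical in
theorem idemProd_image_eq_zero (hΓ : IsPartialProjRep σ Γ) {U : Finset G} (s : G)
    (hU : hΓ.idemProd U = 0) : hΓ.idemProd (insert s (U.image (s * ·))) = 0 := by
  rw [idemProd_insert, (hΓ.idem_commute_idemProd s _).eq, idem, mul_smul_comm, ← mul_assoc,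
    ← hΓ.apply_mul_idemProd, hU]
  simp

/-- A prohibition is a left translate by `s` of one based at `1`, whose product vanishes by the two
preceding lemmas on idempotents. -/
theorem idemProd_eq_zero (hΓ : IsPartialProjRep σ Γ) {U : Finset G} (h1 : 1 ∈ U)
    (hU : (U : Set G) ∉ OmegaSigma σ) : hΓ.idemProd U = 0 := by
  classical
  rw [mem_OmegaSigma_iff] at hU
  simp only [Finset.mem_coe, h1, true_and, not_forall, not_not] at hU
  obtain ⟨V, hV, hsub⟩ := hU
  rcases hV with ⟨s, g, h, hσ, rfl⟩ | ⟨s, g, h, t, hσ, rfl⟩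
  -- The base point `1` of the untranslated prohibition is left out, since `e_1 = 1`; its translate
  -- is the inserted `s`.
  · refine hΓ.idemProd_eq_zero_of_subset (V := insert s (Finset.image (s * ·) {g, g * h})) ?_
      (hΓ.idemProd_image_eq_zero s ?_)
    · rw [← Finset.coe_subset]
      simpa [mul_assoc, Set.image_insert_eq] using hsub
    · rw [← Finset.insert_empty (a := g * h), idemProd_insert, idemProd_insert, ← mul_assoc,
        hΓ.idem_mul_idem_eq_zero hσ, zero_mul]
  · refine hΓ.idemProd_eq_zero_of_subset
      (V := insert s (Finset.image (s * ·) {g, g * h, g * h * t})) ?_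
      (hΓ.idemProd_image_eq_zero s ?_)
    · rw [← Finset.coe_subset]
      simpa [mul_assoc, Set.image_insert_eq] using hsub
    · rw [← Finset.insert_empty (a := g * h * t), idemProd_insert, idemProd_insert,
        idemProd_insert, ← mul_assoc, ← mul_assoc, hΓ.idem_mul_idem_mul_idem_eq_zero hσ, zero_mul]

/-! ### The linear map from `A_σ` back to the target of a representation. -/

/-- The linear map `A_σ → R` sending `(U, g)` to the product of the idempotents attached to the
elements of `U`, times `Γ(g)`. -/
noncomputable def ofAlgA (hΓ : IsPartialProjRep σ Γ) : AlgA σ →ₗ[κ] R :=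
  Finsupp.linearCombination κ fun p : Pairs σ => hΓ.idemProd p.finite.toFinset * Γ p.elt

/-- The formula survives when `pair` takes its default value `0`, because the product of idempotents
vanishes there too. Later computations thus need no case distinction on `Ω_σ`. -/
theorem ofAlgA_pair (hΓ : IsPartialProjRep σ Γ) (U : Finset G) (h1 : 1 ∈ U) {g : G} (hg : g ∈ U) :
    hΓ.ofAlgA (AlgA.pair σ U g) = hΓ.idemProd U * Γ g := by
  by_cases hU : (U : Set G) ∈ OmegaSigma σ
  · let p : Pairs σ := ⟨U, g, hU, U.finite_toSet, hg⟩
    have h : AlgA.pair σ U g = (Finsupp.single p 1 : Pairs σ →₀ κ) := AlgA.pair_of_mem p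
    rw [h]
    refine (Finsupp.linearCombination_single κ 1 p).trans ?_
    rw [one_smul]
    congr 2
    exact Finset.finite_toSet_toFinset U
  · rw [AlgA.pair_eq_zero (fun h => hU h.1), map_zero, hΓ.idemProd_eq_zero h1 hU, zero_mul]

/-- On `(V, h)` this is `Γ(g) e_V Γ(h) = e_{gV} Γ(g) Γ(h) = σ(g, h) e_{gV} e_g Γ(gh)`. Full
multiplicativity of `ofAlgA` is never needed. -/
theorem ofAlgA_pair_mul (hΓ : IsPartialProjRep σ Γ) (g : G) (x : AlgA σ) :
    hΓ.ofAlgA (AlgA.pair σ {1, g} g * x) = Γ g * hΓ.ofAlgA x := by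
  classical
  induction x using AlgA.induction_pair with
  | h0 => rw [AlgA.mul_zero', map_zero, mul_zero]
  | hadd x y hx hy => rw [AlgA.mul_add', map_add, hx, hy, map_add, mul_add]
  | hs k p =>
    rw [AlgA.mul_smul', map_smul, map_smul, mul_smul_comm]
    congr 1
    obtain ⟨V, hV⟩ := p.finite.exists_finset_coe
    have h1 : 1 ∈ V := by rw [← Finset.mem_coe, hV]; exact AlgA.one_mem p
    have hm : p.elt ∈ V := by rw [← Finset.mem_coe, hV]; exact p.elt_mem
    have hset : ({1, g} : Set G) ∪ g • (V : Set G) =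
        ((insert 1 (insert g (V.image (g * ·))) : Finset G) : Set G) := by
      ext x
      simp [Set.mem_smul_set_iff_inv_smul_mem, or_assoc]
    rw [← hV, AlgA.pair_mul_pair (by simp) (by simpa using h1) (by simp) (by simpa using hm),
      hset, map_smul, hΓ.ofAlgA_pair _ (by simp)
        (by simp [hm]), hΓ.ofAlgA_pair V h1 hm, ← mul_assoc, hΓ.apply_mul_idemProd, mul_assoc,
      hΓ.apply_mul_apply, idemProd_insert, idem_one, one_mul, idemProd_insert, mul_smul_comm,
      ← mul_assoc, (hΓ.idem_commute_idemProd g _).eq]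

end IsPartialProjRep

/-! ### The homomorphism from the twisted partial group algebra. -/

section Isomorphism

variable {κ : Type u} {G : Type v} [Field κ] [Group G] (σ : G → G → κ)

theorem bracket_isPartialProjRep [hσ : IsFactorSet σ] : IsPartialProjRep σ (bracket σ) where
  left_zero g h h0 := by
    simpa [bracket] using ParAlgebra.mk_rel (ParRel.left_zero (σ := σ) g h h0)
  right_zero g h h0 := by
    simpa [bracket] using ParAlgebra.mk_rel (ParRel.right_zero (σ := σ) g h h0)
  -- The only axiom that is not a defining relation: a vanishing product of generators is mapped
  -- into a representation realizing `σ`.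
  zero_of_mul g h h0 := by
    obtain ⟨R, _, _, Γ, hΓ⟩ := hσ.exists_rep
    obtain ⟨f, hf⟩ := exists_lift σ Γ hΓ.left_zero hΓ.right_zero hΓ.map_one hΓ.left_mul
      hΓ.right_mul
    apply hΓ.zero_of_mul
    rw [← hf, ← hf, ← map_mul, h0, map_zero]
  map_one := by simpa [bracket] using ParAlgebra.mk_rel (ParRel.one (σ := σ))
  left_mul g h := by simpa [bracket] using ParAlgebra.mk_rel (ParRel.left_mul (σ := σ) g h)
  right_mul g h := by simpa [bracket] using ParAlgebra.mk_rel (ParRel.right_mul (σ := σ) g h)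

theorem ParAlgebra.induction {P : ParAlgebra σ → Prop} (x : ParAlgebra σ)
    (halg : ∀ k, P (algebraMap κ _ k)) (hbr : ∀ g, P (bracket σ g))
    (hmul : ∀ x y, P x → P y → P (x * y)) (hadd : ∀ x y, P x → P y → P (x + y)) : P x := by
  obtain ⟨y, rfl⟩ : ∃ y, ParAlgebra.mk σ y = x := RingQuot.mkAlgHom_surjective κ (ParRel σ) x
  induction y using FreeAlgebra.induction with
  | grade0 r => rw [AlgHom.commutes]; exact halg r
  | grade1 g => exact hbr g
  | mul a b ha hb => rw [map_mul]; exact hmul _ _ ha hb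
  | add a b ha hb => rw [map_add]; exact hadd _ _ ha hb

theorem AlgA.pair_mul_pair_generators (g h : G) :
    pair σ {1, g} g * pair σ {1, h} h = σ g h • pair σ {1, g, g * h} (g * h) := by
  rw [pair_mul_pair (by simp) (by simp) (by simp) (by simp)]
  congr 2
  ext x
  simp [Set.smul_set_insert]
  tauto

theorem AlgA.pair_eq_zero_of_sigma {U : Set G} {s g h : G} (h0 : σ g h = 0) (hs : s ∈ U)
    (hsg : s * g ∈ U) (hsgh : s * g * h ∈ U) (t : G) : pair σ U t = 0 := by
  apply pair_eq_zero
  rintro ⟨hU, -⟩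
  refine ((mem_OmegaSigma_iff σ _).mp hU).2 _ (Or.inl ⟨s, g, h, h0, rfl⟩) ?_
  simp [Set.insert_subset_iff, hs, hsg, hsgh]

/-- The homomorphism `κ_par^σ G → A_σ` exists. -/
theorem exists_toAlgA [IsFactorSet σ] : ∃ f : ParAlgebra σ →ₐ[κ] AlgA σ,
    ∀ g, f (bracket σ g) = AlgA.pair σ {1, g} g := by
  refine exists_lift σ (fun g => AlgA.pair σ {1, g} g) ?_ ?_ ?_ ?_ ?_
  · intro g h h0
    -- The resulting set `{1, g⁻¹, h}` is the translate by `g⁻¹` of the prohibition `{1, g, gh}`.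
    rw [AlgA.pair_mul_pair_generators, AlgA.pair_eq_zero_of_sigma σ (s := g⁻¹) h0 (by simp)
      (by simp) (by simp), smul_zero]
  · intro g h h0
    rw [AlgA.pair_mul_pair_generators, AlgA.pair_eq_zero_of_sigma σ (s := 1) h0 (by simp)
      (by simp) (by simp), smul_zero]
  · simp only [Set.insert_eq_of_mem (Set.mem_singleton (1 : G))]
    rfl
  · intro g h
    have hset : ({1, g⁻¹, g⁻¹ * g} : Set G) ∪ (g⁻¹ * g) • {1, h} = {1, g⁻¹, h} := by
      ext x
      simp
      tauto
    rw [AlgA.pair_mul_pair_generators, AlgA.pair_mul_pair_generators, smul_mul_assoc,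
      AlgA.pair_mul_pair (by simp) (by simp) (by simp) (by simp), hset, smul_smul, smul_smul,
      inv_mul_cancel, one_mul, inv_mul_cancel_left]
    -- The coefficients agree by the cocycle identity for `(g⁻¹, g, h)`; its failure would make `{1,
    -- g⁻¹, h}` a prohibition of type II. In `right_mul` both sides yield the same coefficient
    -- directly.
    by_cases hO : ({1, g⁻¹, h} : Set G) ∈ OmegaSigma σ
    · congr 1
      by_contra hne
      refine ((mem_OmegaSigma_iff σ _).mp hO).2 _ (Or.inr ⟨1, g⁻¹, g, h, fun h' => hne ?_, rfl⟩) ?_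
      · rw [inv_mul_cancel] at h'
        rw [← h', mul_comm]
      · simp [Set.insert_subset_iff]
    · rw [AlgA.pair_eq_zero (fun h => hO h.1), smul_zero, smul_zero]
  · intro g h
    have hset : ({1, g, g * h} : Set G) ∪ (g * h) • {1, h⁻¹} = {1, g * h, g * h * h⁻¹} := by
      ext x
      simp [Set.smul_set_insert]
      tauto
    rw [AlgA.pair_mul_pair_generators, AlgA.pair_mul_pair_generators, smul_mul_assoc,
      AlgA.pair_mul_pair (by simp) (by simp) (by simp) (by simp), hset]

/-! ### Bijectivity. -/

variable {σ}

theorem toAlgA_injective [IsFactorSet σ] {f : ParAlgebra σ →ₐ[κ] AlgA σ}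
    (hf : ∀ g, f (bracket σ g) = AlgA.pair σ {1, g} g) : Function.Injective f := by
  classical
  have hΓ := bracket_isPartialProjRep σ
  -- The free variable `y` makes the property pass to products in `x`; setting `y = 1` then yields
  -- the left inverse.
  have key : ∀ x y, hΓ.ofAlgA (f x * y) = x * hΓ.ofAlgA y := by
    intro x
    induction x using ParAlgebra.induction with
    | halg k =>
      intro y
      rw [AlgHom.commutes, ← Algebra.smul_def, ← Algebra.smul_def, map_smul]
    | hbr g => intro y; rw [hf, hΓ.ofAlgA_pair_mul]
    | hmul a b ha hb => intro y; rw [map_mul f, mul_assoc, ha, hb, mul_assoc]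
    | hadd a b ha hb => intro y; rw [map_add, add_mul, map_add, ha, hb, add_mul]
  have hone : hΓ.ofAlgA 1 = 1 := by
    have h := hΓ.ofAlgA_pair {1} (by simp) (g := 1) (by simp)
    rw [Finset.coe_singleton, hΓ.map_one, ← Finset.insert_empty (a := 1), hΓ.idemProd_insert,
      hΓ.idem_one, hΓ.idemProd_empty, one_mul, one_mul] at h
    exact h
  refine Function.LeftInverse.injective (g := hΓ.ofAlgA) fun x => ?_
  have h := key x 1
  rwa [hone, mul_one, mul_one] at h

theorem toAlgA_surjective [IsFactorSet σ] {f : ParAlgebra σ →ₐ[κ] AlgA σ}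
    (hf : ∀ g, f (bracket σ g) = AlgA.pair σ {1, g} g) : Function.Surjective f := by
  -- The set is built up from `{1, g}` one element at a time.
  have hmem : ∀ (g : G) (S : Set G), S.Finite → AlgA.pair σ ({1, g} ∪ S) g ∈ f.range := by
    intro g S hS
    induction S, hS using Set.Finite.induction_on with
    | empty => exact ⟨bracket σ g, by rw [Set.union_empty]; exact hf g⟩
    | @insert u S _ _ ih =>
      by_cases hO : {1, g} ∪ insert u S ∈ OmegaSigma σ
      · have hV := ((mem_OmegaSigma_iff σ _).mp hO).2
        -- Otherwise `{1, u}`, which is `{1, u, u * u⁻¹}`, would be a prohibition; likewise `{1, g}`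
        -- in the next step.
        have h1 : σ u u⁻¹ ≠ 0 := by
          intro h0
          refine hV _ (Or.inl ⟨1, u, u⁻¹, h0, rfl⟩) ?_
          simp [Set.insert_subset_iff]
        have h2 : σ 1 g ≠ 0 := by
          intro h0
          refine hV _ (Or.inl ⟨1, 1, g, h0, rfl⟩) ?_
          simp [Set.insert_subset_iff]
        have hset : ({1, u, u * u⁻¹} : Set G) ∪ (u * u⁻¹) • ({1, g} ∪ S) =
            {1, g} ∪ insert u S := by
          ext x
          simp
          tauto
        have h3 : f (bracket σ u) * f (bracket σ u⁻¹) * AlgA.pair σ ({1, g} ∪ S) g =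
            σ u u⁻¹ • AlgA.pair σ ({1, g} ∪ insert u S) g := by
          rw [hf, hf, AlgA.pair_mul_pair_generators, smul_mul_assoc,
            AlgA.pair_mul_pair (by simp) (by simp) (by simp) (by simp), hset, mul_inv_cancel,
            one_mul, sigma_one_left h2, one_smul]
        rw [(inv_smul_eq_iff₀ h1).mpr h3 |>.symm]
        exact f.range.smul_mem (f.range.mul_mem (f.range.mul_mem ⟨_, rfl⟩ ⟨_, rfl⟩) ih) _
      · rw [AlgA.pair_eq_zero (fun h => hO h.1)]
        exact f.range.zero_mem
  intro x
  change x ∈ f.range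
  induction x using AlgA.induction_pair with
  | h0 => exact f.range.zero_mem
  | hadd x y hx hy => exact f.range.add_mem hx hy
  | hs k p =>
    refine f.range.smul_mem ?_ k
    have h := hmem p.elt p.set p.finite
    rwa [Set.union_eq_self_of_subset_left] at h
    simp [Set.insert_subset_iff, AlgA.one_mem p, p.elt_mem]

end Isomorphism

end TwistedPartial

theorem mainTheorem1 {κ : Type u} {G : Type v} [Field κ] [Group G]
    (σ : G → G → κ) [TwistedPartial.IsFactorSet σ] :
    ∃ φ : TwistedPartial.ParAlgebra σ ≃ₐ[κ] TwistedPartial.AlgA σ,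
      ∀ g : G, φ (TwistedPartial.bracket σ g) =
        TwistedPartial.chi σ {1, g} • TwistedPartial.AlgA.pair σ {1, g} g := by
  obtain ⟨f, hf⟩ := TwistedPartial.exists_toAlgA σ
  refine ⟨AlgEquiv.ofBijective f
    ⟨TwistedPartial.toAlgA_injective hf, TwistedPartial.toAlgA_surjective hf⟩, fun g => ?_⟩
  rw [TwistedPartial.AlgA.chi_smul_pair]
  exact hf g
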